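/- Let $n\ge 1$, let $P$ be a Borel probability measure on $\mathbb R^n$ with Euclidean norm $\|\cdot\|$, and let $C>0$. Write $\mathcal K(Q|P)=\int\log\frac{dQ}{dP}\,dQ$ for the relative entropy ($+\infty$ if $Q\not\ll P$), $M^+$ for the set of lower semi-continuous functions $\mathbb R^n\to[0,\infty)$, and $\tilde M(P,Q)$ for the set of couplings of $P$ and $Q$, that is, laws $\pi$ of pairs $(X,Y)$ with $X\sim P$ and $Y\sim Q$. For probability measures $P,Q$ on $\mathbb R^n$ define the weak transport costs $$\tilde W_{2,N}(P,Q)=\sup_{\alpha\in M^+}\ \inf_{\pi\in\tilde M(P,Q)}\frac{\pi[\alpha(Y)\|X-Y\|]}{Q[\alpha^2]^{1/2}},\qquad \tilde W^{\mathrm{pr}}_{2,N}(P,Q)=\sup_{\alpha_1,\dots,\alpha_n\in M^+}\ \inf_{\pi\in\tilde M(P,Q)}\frac{\sum_{j=1}^n\pi[\alpha_j(Y)|X_j-Y_j|]}{\big(\sum_{j=1}^nQ[\alpha_j^2]\big)^{1/2}},$$ with the conventions $0/0=\infty/\infty=0$. The first regards $\mathbb R^n$ as a single space with the Euclidean metric,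 the second as the product of $n$ copies of $\mathbb R$. Let $\tilde W$ be either of these two costs. The measure $P$ is said to satisfy $\tilde T_{2,N}(C)$ (for the cost $\tilde W$) if $\tilde W(P,Q)\le\sqrt{2C\,\mathcal K(Q|P)}$ for every probability measure $Q$ on $\mathbb R^n$, and to satisfy $\tilde T^{(i)}_{2,N}(C)$ if $\tilde W(Q,P)\le\sqrt{2C\,\mathcal K(Q|P)}$ for every such $Q$. Proposition. If, for one of the two costs $\tilde W$, $P$ satisfies both $\tilde T_{2,N}(C)$ and $\tilde T^{(i)}_{2,N}(C)$, then for every Borel set $A\subseteq\mathbb R^n$ with convex hull $B$, $$\int\exp\Big(\frac{d_N^2(x,B)}{4C}\Big)\,P(dx)\le\frac1{P(A)},\qquad d_N(x,B)=\inf_{y\in B}\|x-y\|,$$ where the right-hand side is $+\infty$ if $P(A)=0$. -/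

import Mathlib

open MeasureTheory InformationTheory
open scoped ENNReal NNReal

/-- The set of couplings of `P` and `Q`: measures on `E × E`, the law of a pair `(X, Y)`, with first
margin `P` (law of `X`) and second margin `Q` (law of `Y`). -/
def couplings {E : Type*} [MeasurableSpace E] (P Q : Measure E) : Set (Measure (E × E)) :=
  {π | π.map Prod.fst = P ∧ π.map Prod.snd = Q}

/-- The weak transport cost of exponent `p = q = 2` for a finite family of costs `c j`,
`sup_α inf_π (∑ j, π[α_j(Y) c_j(X, Y)]) / (∑ j, Q[α_j(Y)^2])^(1/2)`,
over families of lower semicontinuous nonnegative functions `α_j` and couplings `π` of `(P, Q)`.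
Division in `ℝ≥0∞` obeys `0 / 0 = 0` and `∞ / ∞ = 0`. -/
noncomputable def weakTransportCost {E ι : Type*} [TopologicalSpace E] [MeasurableSpace E]
    [Fintype ι] (c : ι → E → E → ℝ≥0∞) (P Q : Measure E) : ℝ≥0∞ :=
  ⨆ (α : ι → E → ℝ≥0) (_ : ∀ j, LowerSemicontinuous (α j)),
    ⨅ π ∈ couplings P Q,
      (∑ j, ∫⁻ z, (α j z.2 : ℝ≥0∞) * c j z.1 z.2 ∂π) /
        (∑ j, ∫⁻ y, (α j y : ℝ≥0∞) ^ 2 ∂Q) ^ (1 / 2 : ℝ)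

/-- The weak transport inequality: the cost from `P` to `Q` is at most `√(2 C K(Q|P))` for every
probability measure `Q`, where `K(Q|P)` is the relative entropy. -/
def WeakTransportIneq {E ι : Type*} [TopologicalSpace E] [MeasurableSpace E] [Fintype ι]
    (c : ι → E → E → ℝ≥0∞) (C : ℝ) (P : Measure E) : Prop :=
  ∀ Q : Measure E, IsProbabilityMeasure Q →
    weakTransportCost c P Q ≤ (2 * ENNReal.ofReal C * klDiv Q P) ^ (1 / 2 : ℝ)

/-- The inverted weak transport inequality: `P` and `Q` are exchanged in the cost only. -/
def InvWeakTransportIneq {E ι : Type*} [TopologicalSpace E] [MeasurableSpace E] [Fintype ι]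
    (c : ι → E → E → ℝ≥0∞) (C : ℝ) (P : Measure E) : Prop :=
  ∀ Q : Measure E, IsProbabilityMeasure Q →
    weakTransportCost c Q P ≤ (2 * ENNReal.ofReal C * klDiv Q P) ^ (1 / 2 : ℝ)

/-- The Euclidean metric on `ℝⁿ`, as a one-element family of costs: one weight `α`. -/
noncomputable def euclideanCost (n : ℕ) :
    Unit → EuclideanSpace ℝ (Fin n) → EuclideanSpace ℝ (Fin n) → ℝ≥0∞ :=
  fun _ x y => edist x y

/-- The Euclidean metric on `ℝ`, on each factor of the product space `ℝⁿ`: `n` weights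
`α_1, …, α_n`, the `j`-th one for the cost `|x_j - y_j|`. -/
noncomputable def coordinateCost (n : ℕ) :
    Fin n → EuclideanSpace ℝ (Fin n) → EuclideanSpace ℝ (Fin n) → ℝ≥0∞ :=
  fun j x y => edist (x j) (y j)

/-! Let `g` be the distance to B, `φ` a bounded truncation of `g`, `Q` the tilt of `P` by φ²/(4C),
and `ν` the measure `P` conditioned on A. Subgradients of the distance give weights u_j with ∑ u_j²
≤ 1 and g(y) ≤ g(x) + ∑ u_j(y) c_j(x,y). Couple `P` with `Q` using weights φu_j, and let ψ be the
conditional expectation of φ(Y) given X. Then couple `ν` with `P` using weights ψu_j. Since g = 0 on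
A and P[ψ²] ≤ Q[φ²], this chain gives Q[φ²] ≤ (D₁ + D₂) Q[φ²]^{1/2}, where D₁, D₂ bound the two
transport costs (`lintegral_sq_le_of_weakTransportCost_le`). Hence Q[φ²] ≤ 2(D₁² + D₂²) = 4C(K(Q|P)
+ K(ν|P)). By `klDiv_tilted` and `klDiv_cond` the entropies are Q[φ²]/(4C) − log P[exp(φ²/(4C))] and
−log P(A). The terms in Q[φ²] cancel, leaving the claim for φ; monotone convergence gives it for g.
-/

/-! ### Semicontinuous approximation of weights and nearly optimal couplings. -/

/-- Vitali–Carathéodory approximation from above in `L²` for bounded functions. -/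
theorem exists_le_lowerSemicontinuous_lintegral_sq_le {E : Type*} [TopologicalSpace E]
    [MeasurableSpace E] [BorelSpace E] (μ : Measure E) [μ.WeaklyRegular] {f : E → ℝ≥0}
    (hf : Measurable f) {M : ℝ≥0} (hM : ∀ x, f x ≤ M) {ε : ℝ≥0∞} (hε : ε ≠ 0) :
    ∃ g : E → ℝ≥0, (∀ x, f x ≤ g x) ∧ LowerSemicontinuous g ∧
      ∫⁻ x, (g x : ℝ≥0∞) ^ 2 ∂μ ≤ ∫⁻ x, (f x : ℝ≥0∞) ^ 2 ∂μ + ε := by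
  obtain ⟨h, hfh, hlsc, hint⟩ := exists_le_lowerSemicontinuous_lintegral_ge μ
    (fun x => (f x : ℝ≥0∞) ^ 2) (by fun_prop) hε
  -- `h` majorizes f² but may be infinite. Capping it at M² and taking the root still dominates f,
  -- and `T` is continuous and monotone, so semicontinuity survives.
  set T : ℝ≥0∞ → ℝ≥0 := fun t => NNReal.sqrt (min t ((M ^ 2 : ℝ≥0) : ℝ≥0∞)).toNNReal with hT
  have hne : ∀ t : ℝ≥0∞, min t ((M ^ 2 : ℝ≥0) : ℝ≥0∞) ≠ ∞ := fun t =>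
    ne_top_of_le_ne_top ENNReal.coe_ne_top (min_le_right _ _)
  have hTm : Monotone T := fun s t hst =>
    NNReal.sqrt.monotone (ENNReal.toNNReal_mono (hne t) (min_le_min_right _ hst))
  have hTc : Continuous T := by
    refine NNReal.continuous_sqrt.comp ?_
    exact ENNReal.continuousOn_toNNReal.comp_continuous (by fun_prop) hne
  have hTsq : ∀ t, ((T t : ℝ≥0) : ℝ≥0∞) ^ 2 = min t ((M ^ 2 : ℝ≥0) : ℝ≥0∞) := fun t => by
    rw [← ENNReal.coe_pow, hT, NNReal.sq_sqrt, ENNReal.coe_toNNReal (hne t)]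
  refine ⟨fun x => T (h x), fun x => ?_, hTc.comp_lowerSemicontinuous hlsc hTm, ?_⟩
  · rw [← pow_le_pow_iff_left₀ (zero_le) (zero_le) two_ne_zero, ← ENNReal.coe_le_coe,
      ENNReal.coe_pow, ENNReal.coe_pow, hTsq]
    refine le_min (hfh x) ?_
    rw [← ENNReal.coe_pow, ENNReal.coe_le_coe]
    gcongr
    exact hM x
  · refine le_trans (lintegral_mono fun x => ?_) hint
    rw [hTsq]
    exact min_le_left _ _

/-- Nearly optimal couplings for bounded measurable weights. -/
theorem exists_coupling_of_weakTransportCost_le {E ι : Type*} [TopologicalSpace E]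
    [MeasurableSpace E] [BorelSpace E] [Fintype ι] {c : ι → E → E → ℝ≥0∞}
    {P Q : Measure E} [Q.WeaklyRegular] [IsFiniteMeasure Q] {D : ℝ≥0∞} (hD : D ≠ ∞)
    (h : weakTransportCost c P Q ≤ D) {α : ι → E → ℝ≥0} (hα : ∀ j, Measurable (α j)) {M : ℝ≥0}
    (hM : ∀ j x, α j x ≤ M) {ε : ℝ≥0} (hε : 0 < ε) :
    ∃ π ∈ couplings P Q, ∑ j, ∫⁻ z, (α j z.2 : ℝ≥0∞) * c j z.1 z.2 ∂π ≤
      (D + ε) * (∑ j, ∫⁻ y, (α j y : ℝ≥0∞) ^ 2 ∂Q + ε) ^ (1 / 2 : ℝ) := by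
  have hδ : (ε : ℝ≥0∞) / Fintype.card ι ≠ 0 := by simp [hε.ne']
  choose β hαβ hlsc hβ using fun j =>
    exists_le_lowerSemicontinuous_lintegral_sq_le Q (hα j) (hM j) hδ
  have hlt : (⨅ π ∈ couplings P Q, (∑ j, ∫⁻ z, (β j z.2 : ℝ≥0∞) * c j z.1 z.2 ∂π) /
        (∑ j, ∫⁻ y, (β j y : ℝ≥0∞) ^ 2 ∂Q) ^ (1 / 2 : ℝ)) < D + ε :=
    ((le_iSup₂ (f := fun (α : ι → E → ℝ≥0) (_ : ∀ j, LowerSemicontinuous (α j)) =>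
      ⨅ π ∈ couplings P Q, (∑ j, ∫⁻ z, (α j z.2 : ℝ≥0∞) * c j z.1 z.2 ∂π) /
        (∑ j, ∫⁻ y, (α j y : ℝ≥0∞) ^ 2 ∂Q) ^ (1 / 2 : ℝ)) β hlsc).trans h).trans_lt
      (ENNReal.lt_add_right hD (by simpa using hε.ne'))
  simp only [iInf_lt_iff] at hlt
  obtain ⟨π, hπ, hlt⟩ := hlt
  have hsum : ∑ j, ∫⁻ y, (β j y : ℝ≥0∞) ^ 2 ∂Q ≤ ∑ j, ∫⁻ y, (α j y : ℝ≥0∞) ^ 2 ∂Q + ε := by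
    refine (Finset.sum_le_sum fun j _ => hβ j).trans ?_
    rw [Finset.sum_add_distrib]
    gcongr
    rw [Finset.sum_const, nsmul_eq_mul]
    exact ENNReal.mul_div_le
  -- The denominator must be finite: as a / ∞ = 0 for finite a and also for a = ∞, a bound on the
  -- quotient would otherwise say nothing about the numerator.
  have hfin : ∑ j, ∫⁻ y, (α j y : ℝ≥0∞) ^ 2 ∂Q + ε ≠ ∞ := by
    refine ENNReal.add_ne_top.2 ⟨ENNReal.sum_ne_top.2 fun j _ => ?_, ENNReal.coe_ne_top⟩
    refine ne_top_of_le_ne_top (b := ∫⁻ _, (M : ℝ≥0∞) ^ 2 ∂Q) ?_ (lintegral_mono fun y => ?_)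
    · rw [lintegral_const]
      finiteness
    · gcongr
      exact hM j y
  have hfin' : (∑ j, ∫⁻ y, (β j y : ℝ≥0∞) ^ 2 ∂Q) ^ (1 / 2 : ℝ) ≠ ∞ :=
    ENNReal.rpow_ne_top_of_nonneg (by norm_num) (ne_top_of_le_ne_top hfin hsum)
  refine ⟨π, hπ, ?_⟩
  calc ∑ j, ∫⁻ z, (α j z.2 : ℝ≥0∞) * c j z.1 z.2 ∂π
      ≤ ∑ j, ∫⁻ z, (β j z.2 : ℝ≥0∞) * c j z.1 z.2 ∂π := by
        gcongr with j _ z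
        exact hαβ j z.2
    _ ≤ (D + ε) * (∑ j, ∫⁻ y, (β j y : ℝ≥0∞) ^ 2 ∂Q) ^ (1 / 2 : ℝ) :=
        (ENNReal.div_le_iff_le_mul (Or.inr (by finiteness)) (Or.inl hfin')).1 hlt.le
    _ ≤ _ := by gcongr

/-! ### Conditional expectations and the second-moment bound. -/

theorem sq_lintegral_le_lintegral_sq {E : Type*} [MeasurableSpace E] (μ : Measure E)
    [IsProbabilityMeasure μ] {f : E → ℝ≥0∞} (hf : AEMeasurable f μ) :
    (∫⁻ x, f x ∂μ) ^ 2 ≤ ∫⁻ x, f x ^ 2 ∂μ := by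
  have := ENNReal.lintegral_mul_le_Lp_mul_Lq μ Real.HolderConjugate.two_two hf
    (g := fun _ => 1) aemeasurable_const
  simp only [Pi.mul_apply, mul_one, lintegral_const, measure_univ, ENNReal.rpow_two] at this
  calc (∫⁻ x, f x ∂μ) ^ 2 ≤ ((∫⁻ x, f x ^ 2 ∂μ) ^ (1 / 2 : ℝ)) ^ 2 := by
        gcongr
        simpa using this
    _ = _ := by rw [← ENNReal.rpow_two, ← ENNReal.rpow_mul]; norm_num

/-- A bounded function of the second coordinate of a coupling has a bounded conditional expectation
given the first coordinate, and its second moment is not larger. -/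
theorem exists_condExp_snd {E : Type*} [MeasurableSpace E] [StandardBorelSpace E] [Nonempty E]
    {P Q : Measure E} [IsProbabilityMeasure P] {π : Measure (E × E)} (hπ : π ∈ couplings P Q)
    {φ : E → ℝ≥0} (hφ : Measurable φ) {M : ℝ≥0} (hM : ∀ x, φ x ≤ M) :
    ∃ ψ : E → ℝ≥0, Measurable ψ ∧ (∀ x, ψ x ≤ M) ∧
      ∫⁻ x, (ψ x : ℝ≥0∞) ^ 2 ∂P ≤ ∫⁻ y, (φ y : ℝ≥0∞) ^ 2 ∂Q ∧
      ∀ k : E → ℝ≥0∞, Measurable k →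
        ∫⁻ z, (φ z.2 : ℝ≥0∞) * k z.1 ∂π = ∫⁻ x, (ψ x : ℝ≥0∞) * k x ∂P := by
  obtain ⟨h1, h2⟩ := hπ
  have : IsProbabilityMeasure π := by
    constructor
    rw [← Set.preimage_univ (f := Prod.fst), ← Measure.map_apply measurable_fst .univ, h1]
    simp
  have hdis : P.compProd π.condKernel = π := by
    have := π.disintegrate π.condKernel
    rwa [Measure.fst, h1] at this
  have hle : ∀ x, ∫⁻ y, (φ y : ℝ≥0∞) ∂π.condKernel x ≤ M := fun x => by
    refine (lintegral_mono fun y => ENNReal.coe_le_coe.2 (hM y)).trans ?_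
    simp
  have hcoe : ∀ x, (((∫⁻ y, (φ y : ℝ≥0∞) ∂π.condKernel x).toNNReal : ℝ≥0) : ℝ≥0∞) =
      ∫⁻ y, (φ y : ℝ≥0∞) ∂π.condKernel x := fun x =>
    ENNReal.coe_toNNReal (ne_top_of_le_ne_top ENNReal.coe_ne_top (hle x))
  have hint : ∀ k : E × E → ℝ≥0∞, Measurable k →
      ∫⁻ z, k z ∂π = ∫⁻ x, ∫⁻ y, k (x, y) ∂π.condKernel x ∂P := fun k hk => by
    conv_lhs => rw [← hdis]
    exact Measure.lintegral_compProd hk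
  refine ⟨fun x => (∫⁻ y, (φ y : ℝ≥0∞) ∂π.condKernel x).toNNReal, ?_, fun x => ?_, ?_, ?_⟩
  · exact (Measurable.lintegral_kernel (f := fun y => (φ y : ℝ≥0∞)) (by fun_prop)).ennreal_toNNReal
  · rw [← ENNReal.coe_le_coe, hcoe]
    exact hle x
  · simp only [hcoe]
    calc ∫⁻ x, (∫⁻ y, (φ y : ℝ≥0∞) ∂π.condKernel x) ^ 2 ∂P
        ≤ ∫⁻ x, ∫⁻ y, (φ y : ℝ≥0∞) ^ 2 ∂π.condKernel x ∂P :=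
          lintegral_mono fun x => sq_lintegral_le_lintegral_sq _ (by fun_prop)
      _ = ∫⁻ z, (φ z.2 : ℝ≥0∞) ^ 2 ∂π := (hint (fun z => (φ z.2 : ℝ≥0∞) ^ 2) (by fun_prop)).symm
      _ = ∫⁻ y, (φ y : ℝ≥0∞) ^ 2 ∂Q := by
          rw [← h2, lintegral_map (by fun_prop) measurable_snd]
  · intro k hk
    simp only [hcoe]
    rw [hint (fun z => (φ z.2 : ℝ≥0∞) * k z.1) (by fun_prop)]
    refine lintegral_congr fun x => ?_
    exact lintegral_mul_const (k x) (f := fun y => (φ y : ℝ≥0∞)) (by fun_prop)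

/-- Letting ε → 0 in the squared inequality gives S² ≤ D² S. Cancelling S needs it finite, which is
why the functions `φ` are bounded. -/
theorem ENNReal.le_sq_of_forall_le_add_mul_rpow_add {S D : ℝ≥0∞} (hS : S ≠ ∞) (hD : D ≠ ∞)
    (h : ∀ ε : ℝ≥0, 0 < ε → S ≤ (D + ε) * (S + ε) ^ (1 / 2 : ℝ)) : S ≤ D ^ 2 := by
  lift S to ℝ≥0 using hS
  lift D to ℝ≥0 using hD
  have h' : ∀ ε : ℝ≥0, 0 < ε → S ^ 2 ≤ (D + ε) ^ 2 * (S + ε) := fun ε hε => by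
    have := pow_le_pow_left' (h ε hε) 2
    rw [mul_pow, ← ENNReal.rpow_two (_ ^ (1 / 2 : ℝ)), ← ENNReal.rpow_mul] at this
    norm_num at this
    exact_mod_cast this
  have hlim : Filter.Tendsto (fun ε : ℝ≥0 => (D + ε) ^ 2 * (S + ε)) (nhdsWithin 0 (Set.Ioi 0))
      (nhds ((D + 0) ^ 2 * (S + 0))) :=
    (Continuous.tendsto (by fun_prop) 0).mono_left nhdsWithin_le_nhds
  have key : S ^ 2 ≤ (D + 0) ^ 2 * (S + 0) :=
    ge_of_tendsto hlim (Filter.eventually_of_mem self_mem_nhdsWithin fun ε hε => h' ε hε)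
  rw [add_zero, add_zero, sq S] at key
  norm_cast
  rcases eq_or_ne S 0 with rfl | hS0
  · simp
  · exact le_of_mul_le_mul_right key (pos_iff_ne_zero.2 hS0)

/-- The second moment of a function that vanishes `ν`-almost everywhere is controlled by the weak
transport costs along `ν, P, Q`. -/
theorem lintegral_sq_le_of_weakTransportCost_le {E ι : Type*} [TopologicalSpace E]
    [MeasurableSpace E] [BorelSpace E] [StandardBorelSpace E] [Nonempty E]
    [Fintype ι] {c : ι → E → E → ℝ≥0∞} (hc : ∀ j, Measurable fun z : E × E => c j z.1 z.2)
    {P Q ν : Measure E} [IsProbabilityMeasure P] [IsProbabilityMeasure Q]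
    [P.WeaklyRegular] [Q.WeaklyRegular] {D₁ D₂ : ℝ≥0∞} (hD₁ : D₁ ≠ ∞) (hD₂ : D₂ ≠ ∞)
    (h₁ : weakTransportCost c P Q ≤ D₁) (h₂ : weakTransportCost c ν P ≤ D₂)
    {g : E → ℝ≥0} (hg : Measurable g) {u : ι → E → ℝ≥0} (hu : ∀ j, Measurable (u j))
    (hu1 : ∀ y, ∑ j, u j y ^ 2 ≤ 1)
    (hgu : ∀ x y, (g y : ℝ≥0∞) ≤ g x + ∑ j, (u j y : ℝ≥0∞) * c j x y)
    (hgR : ∀ᵐ x ∂ν, g x = 0) {φ : E → ℝ≥0} (hφ : Measurable φ) (hφg : ∀ x, φ x ≤ g x)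
    {M : ℝ≥0} (hM : ∀ x, φ x ≤ M) :
    ∫⁻ y, (φ y : ℝ≥0∞) ^ 2 ∂Q ≤ (D₁ + D₂) ^ 2 := by
  have hu1' : ∀ j y, u j y ≤ 1 := fun j y => by
    have : u j y ^ 2 ≤ 1 :=
      (Finset.single_le_sum (f := fun j => u j y ^ 2) (fun _ _ => zero_le)
        (Finset.mem_univ j)).trans (hu1 y)
    exact (pow_le_one_iff_of_nonneg zero_le two_ne_zero).1 this
  have hbd : ∀ {ψ : E → ℝ≥0}, (∀ x, ψ x ≤ M) → ∀ j x, ψ x * u j x ≤ M := fun hψ j x =>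
    (mul_le_mul' (hψ x) (hu1' j x)).trans (mul_one M).le
  have hsum : ∀ {ψ : E → ℝ≥0} (_ : Measurable ψ) (μ : Measure E),
      ∑ j, ∫⁻ y, ((ψ y * u j y : ℝ≥0) : ℝ≥0∞) ^ 2 ∂μ ≤ ∫⁻ y, (ψ y : ℝ≥0∞) ^ 2 ∂μ :=
    fun {ψ} hψ μ => by
      rw [← lintegral_finsetSum _ (fun j _ => by fun_prop)]
      refine lintegral_mono fun y => ?_
      have : ∑ j, (ψ y * u j y) ^ 2 ≤ ψ y ^ 2 := by
        simp only [mul_pow, ← Finset.mul_sum]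
        exact mul_le_of_le_one_right' (hu1 y)
      simpa only [ENNReal.ofNNReal_finsetSum, ENNReal.coe_pow] using
        ENNReal.coe_le_coe.2 this
  have hcost : ∀ {ψ : E → ℝ≥0} (_ : Measurable ψ) (π : Measure (E × E)),
      ∫⁻ z, (ψ z.2 : ℝ≥0∞) * g z.2 ∂π ≤ ∫⁻ z, (ψ z.2 : ℝ≥0∞) * g z.1 ∂π +
        ∑ j, ∫⁻ z, ((ψ z.2 * u j z.2 : ℝ≥0) : ℝ≥0∞) * c j z.1 z.2 ∂π := fun {ψ} hψ π => by
    rw [← lintegral_finsetSum _ (fun j _ => by have := hc j; fun_prop),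
      ← lintegral_add_left (by fun_prop)]
    refine lintegral_mono fun z => ?_
    refine (mul_le_mul_right (hgu z.1 z.2) _).trans (le_of_eq ?_)
    rw [mul_add, Finset.mul_sum]
    simp only [ENNReal.coe_mul, mul_assoc]
  have hSfin : ∫⁻ y, (φ y : ℝ≥0∞) ^ 2 ∂Q ≠ ∞ := by
    refine ne_top_of_le_ne_top (b := ∫⁻ _, (M : ℝ≥0∞) ^ 2 ∂Q) ?_ (lintegral_mono fun y => ?_)
    · rw [lintegral_const]
      finiteness
    · gcongr
      exact hM y
  refine ENNReal.le_sq_of_forall_le_add_mul_rpow_add hSfin (by finiteness) fun ε hε => ?_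
  have hε2 : 0 < ε / 2 := half_pos hε
  obtain ⟨π₁, hπ₁, hle₁⟩ := exists_coupling_of_weakTransportCost_le hD₁ h₁
    (α := fun j y => φ y * u j y) (fun j => by fun_prop) (hbd hM) hε2
  obtain ⟨ψ, hψ, hψM, hψsq, hψint⟩ := exists_condExp_snd hπ₁ hφ hM
  -- The second margin of `π₂` is the first margin of `π₁`, namely `P`; replacing `φ` by `ψ` lets
  -- the two couplings be chained without being glued.
  obtain ⟨π₂, hπ₂, hle₂⟩ := exists_coupling_of_weakTransportCost_le hD₂ h₂
    (α := fun j y => ψ y * u j y) (fun j => by fun_prop) (hbd hψM) hε2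
  have hhalf : ((ε / 2 : ℝ≥0) : ℝ≥0∞) ≤ ε := ENNReal.coe_le_coe.2 (half_le_self zero_le)
  have hzero : ∫⁻ z, (ψ z.2 : ℝ≥0∞) * g z.1 ∂π₂ = 0 := by
    rw [← hπ₂.1] at hgR
    have := ae_of_ae_map measurable_fst.aemeasurable hgR
    rw [lintegral_eq_zero_iff (by fun_prop)]
    filter_upwards [this] with z hz
    simp [hz]
  calc ∫⁻ y, (φ y : ℝ≥0∞) ^ 2 ∂Q = ∫⁻ z, (φ z.2 : ℝ≥0∞) ^ 2 ∂π₁ := by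
        rw [← hπ₁.2, lintegral_map (by fun_prop) measurable_snd]
    _ ≤ ∫⁻ z, (φ z.2 : ℝ≥0∞) * g z.2 ∂π₁ := by
        refine lintegral_mono fun z => ?_
        simp only [sq]
        gcongr
        exact hφg z.2
    _ ≤ ∫⁻ z, (φ z.2 : ℝ≥0∞) * g z.1 ∂π₁ +
        ∑ j, ∫⁻ z, ((φ z.2 * u j z.2 : ℝ≥0) : ℝ≥0∞) * c j z.1 z.2 ∂π₁ := hcost hφ π₁
    _ = ∫⁻ z, (ψ z.2 : ℝ≥0∞) * g z.2 ∂π₂ +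
        ∑ j, ∫⁻ z, ((φ z.2 * u j z.2 : ℝ≥0) : ℝ≥0∞) * c j z.1 z.2 ∂π₁ := by
        rw [hψint (fun x => g x) (by fun_prop), ← hπ₂.2,
          lintegral_map (by fun_prop) measurable_snd]
    _ ≤ (D₂ + (ε / 2 : ℝ≥0)) * (∫⁻ y, (φ y : ℝ≥0∞) ^ 2 ∂Q + ε) ^ (1 / 2 : ℝ) +
        (D₁ + (ε / 2 : ℝ≥0)) * (∫⁻ y, (φ y : ℝ≥0∞) ^ 2 ∂Q + ε) ^ (1 / 2 : ℝ) := by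
        refine add_le_add ?_ (hle₁.trans ?_)
        · refine (hcost hψ π₂).trans ?_
          rw [hzero, zero_add]
          refine hle₂.trans ?_
          gcongr
          exact (hsum hψ P).trans hψsq
        · gcongr
          exact hsum hφ Q
    _ = (D₁ + D₂ + ε) * (∫⁻ y, (φ y : ℝ≥0∞) ^ 2 ∂Q + ε) ^ (1 / 2 : ℝ) := by
        rw [← add_mul]
        congr 1
        rw [show D₂ + ((ε / 2 : ℝ≥0) : ℝ≥0∞) + (D₁ + ((ε / 2 : ℝ≥0) : ℝ≥0∞)) =
          D₁ + D₂ + (((ε / 2 : ℝ≥0) : ℝ≥0∞) + ((ε / 2 : ℝ≥0) : ℝ≥0∞)) by ring,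
          ← ENNReal.coe_add, add_halves]

/-! ### Projection onto a convex set and subgradients of the distance. -/

open scoped RealInnerProductSpace in
/-- The metric projection onto a nonempty complete convex set. -/
theorem exists_lipschitz_metric_projection {E : Type*} [NormedAddCommGroup E]
    [InnerProductSpace ℝ E] {K : Set E} (hne : K.Nonempty) (hK : IsComplete K)
    (hconv : Convex ℝ K) :
    ∃ p : E → E, LipschitzWith 1 p ∧ (∀ x, Metric.infDist x K = ‖x - p x‖) ∧ (∀ x, p x ∈ K) ∧
      ∀ x, ∀ w ∈ K, ⟪x - p x, w - p x⟫ ≤ 0 := by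
  choose p hpK hp using exists_norm_eq_iInf_of_complete_convex hne hK hconv
  have hvar : ∀ x, ∀ w ∈ K, ⟪x - p x, w - p x⟫ ≤ 0 := fun x =>
    (norm_eq_iInf_iff_real_inner_le_zero hconv (hpK x)).1 (hp x)
  refine ⟨p, LipschitzWith.of_dist_le_mul fun x y => ?_, fun x => ?_, hpK, hvar⟩
  · rw [NNReal.coe_one, one_mul, dist_eq_norm, dist_eq_norm]
    have h1 := hvar x (p y) (hpK y)
    have h2 := hvar y (p x) (hpK x)
    have h3 : ‖p x - p y‖ ^ 2 ≤ ⟪x - y, p x - p y⟫ := by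
      rw [← real_inner_self_eq_norm_sq]
      simp only [inner_sub_left, inner_sub_right] at h1 h2 ⊢
      linarith
    have h4 := h3.trans (real_inner_le_norm (x - y) (p x - p y))
    rcases (norm_nonneg (p x - p y)).eq_or_lt with h0 | h0
    · rw [← h0]
      positivity
    · rw [sq] at h4
      exact le_of_mul_le_mul_right h4 h0
  · rw [hp x, Metric.infDist_eq_iInf]
    simp only [dist_eq_norm]

open scoped RealInnerProductSpace in
/-- A measurable choice of the absolute values of the coordinates of a subgradient of the distance
to a convex set. -/
theorem exists_measurable_abs_subgradient_infDist {n : ℕ} {B : Set (EuclideanSpace ℝ (Fin n))}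
    (hne : B.Nonempty) (hconv : Convex ℝ B) :
    ∃ u : Fin n → EuclideanSpace ℝ (Fin n) → ℝ≥0, (∀ j, Measurable (u j)) ∧
      (∀ y, ∑ j, u j y ^ 2 ≤ 1) ∧
      ∀ x y, Metric.infDist y B ≤ Metric.infDist x B + ∑ j, u j y * dist (x j) (y j) := by
  obtain ⟨p, hlip, hdist, hpK, hvar⟩ := exists_lipschitz_metric_projection hne.closure
    isClosed_closure.isComplete hconv.closure
  simp only [Metric.infDist_closure] at hdist
  have hp : Measurable p := hlip.continuous.measurable
  -- Off the closure of B, the gradient of the distance is (y − p y)/‖y − p y‖; on it, 0/0 = 0 gives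
  -- zero weights.
  refine ⟨fun j y => ‖(y - p y) j‖₊ / ‖y - p y‖₊, fun j => ?_, fun y => ?_, fun x y => ?_⟩
  · have h : Measurable fun y => y - p y := measurable_id.sub hp
    have hj : Measurable fun y => (y - p y) j :=
      (EuclideanSpace.proj (𝕜 := ℝ) j).continuous.measurable.comp h
    exact hj.nnnorm.div h.nnnorm
  · rw [← NNReal.coe_le_coe]
    push_cast
    simp only [div_pow]
    rw [← Finset.sum_div, ← EuclideanSpace.norm_sq_eq]
    exact div_self_le_one _
  · push_cast
    rw [hdist y, hdist x]
    rcases (norm_nonneg (y - p y)).eq_or_lt with h0 | h0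
    · rw [← h0]
      positivity
    · rw [← mul_le_mul_iff_right₀ h0, mul_add, Finset.mul_sum]
      -- The first term is estimated coordinatewise, the second by Cauchy–Schwarz; the third is
      -- nonpositive because `p x` lies in the closure of B.
      have h1 : ‖y - p y‖ * ‖y - p y‖ =
          ⟪y - p y, y - x⟫ + ⟪y - p y, x - p x⟫ + ⟪y - p y, p x - p y⟫ := by
        rw [← real_inner_self_eq_norm_mul_norm, ← inner_add_right, ← inner_add_right]
        congr 1
        abel
      have h2 : ⟪y - p y, y - x⟫ ≤ ∑ j, ‖y - p y‖ * (‖(y - p y) j‖ / ‖y - p y‖ *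
          dist (x j) (y j)) := by
        rw [PiLp.inner_apply]
        refine Finset.sum_le_sum fun j _ => ?_
        rw [← mul_assoc, mul_div_cancel₀ _ h0.ne', dist_comm, dist_eq_norm]
        exact real_inner_le_norm _ _
      have h3 := real_inner_le_norm (y - p y) (x - p x)
      have h4 := hvar y (p x) (hpK x)
      linarith

/-! ### Relative entropies of conditioned and tilted measures. -/

open scoped ProbabilityTheory in
theorem llr_cond {E : Type*} [MeasurableSpace E] (P : Measure E) [IsProbabilityMeasure P]
    {A : Set E} (hA : MeasurableSet A) (hPA : P A ≠ 0) :
    llr P[|A] P =ᵐ[P[|A]] fun _ => -Real.log (P.real A) := by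
  have hac : P[|A] ≪ P := ProbabilityTheory.cond_absolutelyContinuous
  have h1 := hac.ae_le (Measure.rnDeriv_smul_left_of_ne_top (P.restrict A) P
    (ENNReal.inv_ne_top.2 hPA))
  have h2 := hac.ae_le (Measure.rnDeriv_restrict_self P hA)
  filter_upwards [h1, h2, ProbabilityTheory.ae_cond_mem hA] with x hx1 hx2 hxA
  rw [llr, ProbabilityTheory.cond, hx1, Pi.smul_apply, hx2, Set.indicator_of_mem hxA]
  simp [Measure.real, ENNReal.toReal_inv]

open scoped ProbabilityTheory in
/-- The relative entropy of a conditioned measure. -/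
theorem klDiv_cond {E : Type*} [MeasurableSpace E] (P : Measure E) [IsProbabilityMeasure P]
    {A : Set E} (hA : MeasurableSet A) (hPA : P A ≠ 0) :
    klDiv P[|A] P ≠ ∞ ∧ (klDiv P[|A] P).toReal = -Real.log (P.real A) := by
  have := ProbabilityTheory.cond_isProbabilityMeasure hPA
  have hac : P[|A] ≪ P := ProbabilityTheory.cond_absolutelyContinuous
  have hllr := llr_cond P hA hPA
  refine ⟨klDiv_ne_top hac ((integrable_congr hllr).2 (integrable_const _)), ?_⟩
  rw [toReal_klDiv_of_measure_eq hac (by simp), integral_congr_ae hllr]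
  simp

/-- The relative entropy of an exponentially tilted measure. -/
theorem klDiv_tilted {E : Type*} [MeasurableSpace E] (P : Measure E) [IsProbabilityMeasure P]
    {f : E → ℝ} (hf : Integrable (fun x => Real.exp (f x)) P) (hfi : Integrable f (P.tilted f)) :
    klDiv (P.tilted f) P ≠ ∞ ∧
      (klDiv (P.tilted f) P).toReal = ∫ x, f x ∂P.tilted f - Real.log (∫ x, Real.exp (f x) ∂P) := by
  have := isProbabilityMeasure_tilted hf
  have hac := tilted_absolutelyContinuous P f
  have hllr : llr (P.tilted f) P =ᵐ[P.tilted f] fun x => f x - Real.log (∫ x, Real.exp (f x) ∂P) :=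
    hac.ae_le (log_rnDeriv_tilted_left_self hf)
  refine ⟨klDiv_ne_top hac ((integrable_congr hllr).2 (hfi.sub (integrable_const _))), ?_⟩
  rw [toReal_klDiv_of_measure_eq hac (by simp), integral_congr_ae hllr,
    integral_sub hfi (integrable_const _)]
  simp

theorem ENNReal.add_sq_le_two_mul {a b : ℝ≥0∞} (ha : a ≠ ∞) (hb : b ≠ ∞) :
    (a + b) ^ 2 ≤ 2 * (a ^ 2 + b ^ 2) := by
  lift a to ℝ≥0 using ha
  lift b to ℝ≥0 using hb
  exact_mod_cast (add_sq_le : (a + b) ^ 2 ≤ 2 * (a ^ 2 + b ^ 2))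

/-! ### From the second-moment bound to exponential integrability. -/

open scoped ProbabilityTheory in
/-- Exponential square integrability under the two weak transport inequalities, for bounded
functions. -/
theorem lintegral_exp_sq_le_of_weakTransportIneq_of_le {E ι : Type*} [TopologicalSpace E]
    [TopologicalSpace.PseudoMetrizableSpace E]
    [MeasurableSpace E] [BorelSpace E] [StandardBorelSpace E] [Nonempty E]
    [Fintype ι] {c : ι → E → E → ℝ≥0∞} (hc : ∀ j, Measurable fun z : E × E => c j z.1 z.2)
    {P : Measure E} [IsProbabilityMeasure P] {C : ℝ} (hC : 0 < C)
    (h₁ : WeakTransportIneq c C P) (h₂ : InvWeakTransportIneq c C P)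
    {g : E → ℝ≥0} (hg : Measurable g) {u : ι → E → ℝ≥0} (hu : ∀ j, Measurable (u j))
    (hu1 : ∀ y, ∑ j, u j y ^ 2 ≤ 1)
    (hgu : ∀ x y, (g y : ℝ≥0∞) ≤ g x + ∑ j, (u j y : ℝ≥0∞) * c j x y)
    {A : Set E} (hA : MeasurableSet A) (hgA : ∀ x ∈ A, g x = 0)
    {φ : E → ℝ≥0} (hφ : Measurable φ) (hφg : ∀ x, φ x ≤ g x) {M : ℝ≥0} (hM : ∀ x, φ x ≤ M) :
    ∫⁻ x, ENNReal.ofReal (Real.exp ((φ x : ℝ) ^ 2 / (4 * C))) ∂P ≤ 1 / P A := by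
  rcases eq_or_ne (P A) 0 with hPA | hPA
  · simp [hPA]
  have := ProbabilityTheory.cond_isProbabilityMeasure hPA
  set f : E → ℝ := fun x => (φ x : ℝ) ^ 2 / (4 * C) with hf
  have hfm : Measurable f := by fun_prop
  have hf0 : ∀ x, 0 ≤ f x := fun x => by positivity
  have hfM : ∀ x, f x ≤ (M : ℝ) ^ 2 / (4 * C) := fun x => by
    simp only [hf]
    gcongr
    exact hM x
  have hexp : Integrable (fun x => Real.exp (f x)) P :=
    Integrable.of_bound (by fun_prop) (Real.exp ((M : ℝ) ^ 2 / (4 * C)))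
      (ae_of_all _ fun x => by
        rw [Real.norm_eq_abs, Real.abs_exp]
        exact Real.exp_le_exp.2 (hfM x))
  have := isProbabilityMeasure_tilted hexp
  have hfi : Integrable f (P.tilted f) :=
    Integrable.of_bound (by fun_prop) ((M : ℝ) ^ 2 / (4 * C))
      (ae_of_all _ fun x => by
        rw [Real.norm_eq_abs, abs_of_nonneg (hf0 x)]
        exact hfM x)
  obtain ⟨hK, hK'⟩ := klDiv_tilted P hexp hfi
  obtain ⟨hL, hL'⟩ := klDiv_cond P hA hPA
  have hsqrt : ∀ t : ℝ≥0∞, (t ^ (1 / 2 : ℝ)) ^ 2 = t := fun t => by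
    rw [← ENNReal.rpow_two, ← ENNReal.rpow_mul]
    norm_num
  have hD : ∀ {t : ℝ≥0∞}, t ≠ ∞ → (2 * ENNReal.ofReal C * t) ^ (1 / 2 : ℝ) ≠ ∞ := fun ht =>
    ENNReal.rpow_ne_top_of_nonneg (by norm_num) (by finiteness)
  have hgR : ∀ᵐ x ∂P[|A], g x = 0 := by
    filter_upwards [ProbabilityTheory.ae_cond_mem hA] with x hx using hgA x hx
  have hmain : ∫⁻ y, (φ y : ℝ≥0∞) ^ 2 ∂P.tilted f ≤
      4 * ENNReal.ofReal C * (klDiv (P.tilted f) P + klDiv P[|A] P) := by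
    refine (lintegral_sq_le_of_weakTransportCost_le hc (hD hK) (hD hL) (h₁ _ inferInstance)
      (h₂ _ inferInstance) hg hu hu1 hgu hgR hφ hφg hM).trans ?_
    -- The constant 4C arises here: 2 from the square of the sum, 2C from each squared cost.
    refine (ENNReal.add_sq_le_two_mul (hD hK) (hD hL)).trans (le_of_eq ?_)
    rw [hsqrt, hsqrt]
    ring
  have hreal : ∫ x, f x ∂P.tilted f ≤
      (∫ x, f x ∂P.tilted f - Real.log (∫ x, Real.exp (f x) ∂P)) + -Real.log (P.real A) := by
    have h := ENNReal.toReal_mono (by finiteness) hmain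
    rw [ENNReal.toReal_mul, ENNReal.toReal_add hK hL, hK', hL', ENNReal.toReal_mul,
      ENNReal.toReal_ofReal hC.le] at h
    have h' : (∫⁻ y, (φ y : ℝ≥0∞) ^ 2 ∂P.tilted f).toReal = ∫ x, (φ x : ℝ) ^ 2 ∂P.tilted f := by
      rw [integral_eq_lintegral_of_nonneg_ae (ae_of_all _ fun x => by positivity) (by fun_prop)]
      congr 1
      refine lintegral_congr fun x => ?_
      rw [ENNReal.ofReal_pow (by positivity), ENNReal.ofReal_coe_nnreal]
    rw [h', show ENNReal.toReal 4 = 4 from rfl] at h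
    have h4 : ∫ x, f x ∂P.tilted f = (∫ x, (φ x : ℝ) ^ 2 ∂P.tilted f) / (4 * C) := by
      rw [← integral_div]
    rw [← div_le_iff₀' (by positivity), ← h4] at h
    exact h
  have hPA' : 0 < P.real A := ENNReal.toReal_pos hPA (by finiteness)
  have hZ : 0 < ∫ x, Real.exp (f x) ∂P := integral_exp_pos hexp
  have hZle : ∫ x, Real.exp (f x) ∂P ≤ (P.real A)⁻¹ := by
    rw [← Real.log_le_log_iff hZ (by positivity), Real.log_inv]
    linarith
  rw [← ofReal_integral_eq_lintegral_ofReal hexp (ae_of_all _ fun x => (Real.exp_pos _).le),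
    one_div, ← ENNReal.ofReal_toReal (ENNReal.inv_ne_top.2 hPA), ENNReal.toReal_inv]
  exact ENNReal.ofReal_le_ofReal hZle

/-- Exponential square integrability under the two weak transport inequalities. -/
theorem lintegral_exp_sq_le_of_weakTransportIneq {E ι : Type*} [TopologicalSpace E]
    [TopologicalSpace.PseudoMetrizableSpace E]
    [MeasurableSpace E] [BorelSpace E] [StandardBorelSpace E] [Nonempty E]
    [Fintype ι] {c : ι → E → E → ℝ≥0∞} (hc : ∀ j, Measurable fun z : E × E => c j z.1 z.2)
    {P : Measure E} [IsProbabilityMeasure P] {C : ℝ} (hC : 0 < C)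
    (h₁ : WeakTransportIneq c C P) (h₂ : InvWeakTransportIneq c C P)
    {g : E → ℝ≥0} (hg : Measurable g) {u : ι → E → ℝ≥0} (hu : ∀ j, Measurable (u j))
    (hu1 : ∀ y, ∑ j, u j y ^ 2 ≤ 1)
    (hgu : ∀ x y, (g y : ℝ≥0∞) ≤ g x + ∑ j, (u j y : ℝ≥0∞) * c j x y)
    {A : Set E} (hA : MeasurableSet A) (hgA : ∀ x ∈ A, g x = 0) :
    ∫⁻ x, ENNReal.ofReal (Real.exp ((g x : ℝ) ^ 2 / (4 * C))) ∂P ≤ 1 / P A := by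
  have hlim := lintegral_tendsto_of_tendsto_of_monotone (μ := P)
    (f := fun m x => ENNReal.ofReal (Real.exp (((min (g x) (m : ℝ≥0) : ℝ≥0) : ℝ) ^ 2 / (4 * C))))
    (F := fun x => ENNReal.ofReal (Real.exp ((g x : ℝ) ^ 2 / (4 * C))))
    (fun m => by fun_prop) (ae_of_all _ fun x m k hmk => ?_) (ae_of_all _ fun x => ?_)
  · refine le_of_tendsto' hlim fun m => ?_
    exact lintegral_exp_sq_le_of_weakTransportIneq_of_le hc hC h₁ h₂ hg hu hu1 hgu hA hgA
      (φ := fun x => min (g x) (m : ℝ≥0)) (by fun_prop) (fun x => min_le_left _ _)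
      (fun x => min_le_right _ (m : ℝ≥0))
  · have : min (g x) (m : ℝ≥0) ≤ min (g x) (k : ℝ≥0) := min_le_min_left _ (by exact_mod_cast hmk)
    simp only
    gcongr
  · refine tendsto_const_nhds.congr' ?_
    obtain ⟨N, hN⟩ := exists_nat_ge (g x)
    filter_upwards [Filter.eventually_ge_atTop N] with m hm
    rw [min_eq_left (hN.trans (by exact_mod_cast hm))]

/-- Exponential square integrability of the distance to a set under the two weak transport
inequalities, given weights that dominate the increments of the distance. -/
theorem lintegral_exp_sq_infDist_le {n : ℕ} {ι : Type*} [Fintype ι]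
    {c : ι → EuclideanSpace ℝ (Fin n) → EuclideanSpace ℝ (Fin n) → ℝ}
    (hc : ∀ j, Measurable fun z : EuclideanSpace ℝ (Fin n) × EuclideanSpace ℝ (Fin n) =>
      c j z.1 z.2) (hc0 : ∀ j x y, 0 ≤ c j x y)
    {P : Measure (EuclideanSpace ℝ (Fin n))} [IsProbabilityMeasure P] {C : ℝ} (hC : 0 < C)
    (h₁ : WeakTransportIneq (fun j x y => ENNReal.ofReal (c j x y)) C P)
    (h₂ : InvWeakTransportIneq (fun j x y => ENNReal.ofReal (c j x y)) C P)
    {A B : Set (EuclideanSpace ℝ (Fin n))} (hA : MeasurableSet A) (hAB : A ⊆ B)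
    {u : ι → EuclideanSpace ℝ (Fin n) → ℝ≥0} (hu : ∀ j, Measurable (u j))
    (hu1 : ∀ y, ∑ j, u j y ^ 2 ≤ 1)
    (hBu : ∀ x y, Metric.infDist y B ≤ Metric.infDist x B + ∑ j, u j y * c j x y) :
    ∫⁻ x, ENNReal.ofReal (Real.exp (Metric.infDist x B ^ 2 / (4 * C))) ∂P ≤ 1 / P A := by
  refine lintegral_exp_sq_le_of_weakTransportIneq (fun j => (hc j).ennreal_ofReal) hC h₁ h₂
    (g := fun x => Metric.infNndist x B) (by fun_prop) hu hu1 (fun x y => ?_) hA fun x hx => ?_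
  · have h := ENNReal.ofReal_le_ofReal (hBu x y)
    have h0 : ∀ j ∈ Finset.univ, 0 ≤ (u j y : ℝ) * c j x y := fun j _ =>
      mul_nonneg (u j y).2 (hc0 j x y)
    rw [ENNReal.ofReal_add Metric.infDist_nonneg (Finset.sum_nonneg h0),
      ENNReal.ofReal_sum_of_nonneg h0] at h
    simp only [← Metric.coe_infNndist, ENNReal.ofReal_coe_nnreal,
      ENNReal.ofReal_mul (NNReal.coe_nonneg _)] at h
    exact h
  · rw [← NNReal.coe_eq_zero, Metric.coe_infNndist]
    exact Metric.infDist_zero_of_mem (hAB hx)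

theorem mainTheorem7 (n : ℕ) (P : Measure (EuclideanSpace ℝ (Fin n))) [IsProbabilityMeasure P]
    (C : ℝ) (hC : 0 < C) :
    (WeakTransportIneq (euclideanCost n) C P ∧ InvWeakTransportIneq (euclideanCost n) C P →
      ∀ A : Set (EuclideanSpace ℝ (Fin n)), MeasurableSet A →
        ∫⁻ x, ENNReal.ofReal (Real.exp (Metric.infDist x (convexHull ℝ A) ^ 2 / (4 * C))) ∂P
          ≤ 1 / P A) ∧
    (WeakTransportIneq (coordinateCost n) C P ∧ InvWeakTransportIneq (coordinateCost n) C P →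
      ∀ A : Set (EuclideanSpace ℝ (Fin n)), MeasurableSet A →
        ∫⁻ x, ENNReal.ofReal (Real.exp (Metric.infDist x (convexHull ℝ A) ^ 2 / (4 * C))) ∂P
          ≤ 1 / P A) := by

  refine ⟨fun ⟨h₁, h₂⟩ A hA => ?_, fun ⟨h₁, h₂⟩ A hA => ?_⟩
  · have hcost : euclideanCost n = fun _ x y => ENNReal.ofReal (dist x y) := by
      funext _ x y
      exact edist_dist x y
    rw [hcost] at h₁ h₂
    -- The distance to any set is 1-Lipschitz, so the constant weight 1 suffices; convexity matters
    -- only for the coordinate cost.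
    refine lintegral_exp_sq_infDist_le (c := fun _ x y => dist x y) (fun _ => by fun_prop)
      (fun _ _ _ => dist_nonneg) hC h₁ h₂ hA (subset_convexHull ℝ A) (u := fun _ _ => 1)
      (fun _ => measurable_const) (fun _ => by simp) fun x y => ?_
    simpa [dist_comm] using
      Metric.infDist_le_infDist_add_dist (s := convexHull ℝ A) (x := y) (y := x)
  -- The projection needs a nonempty set; for empty A the right-hand side is 1 / 0 = ∞.
  · rcases A.eq_empty_or_nonempty with rfl | hne
    · simp
    have hcost : coordinateCost n = fun j x y => ENNReal.ofReal (dist (x j) (y j)) := by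
      funext j x y
      exact edist_dist _ _
    rw [hcost] at h₁ h₂
    obtain ⟨u, hu, hu1, hBu⟩ := exists_measurable_abs_subgradient_infDist
      (hne.mono (subset_convexHull ℝ A)) (convex_convexHull ℝ A)
    exact lintegral_exp_sq_infDist_le (c := fun j x y => dist (x j) (y j)) (fun _ => by fun_prop)
      (fun _ _ _ => dist_nonneg) hC h₁ h₂ hA (subset_convexHull ℝ A) hu hu1 hBu
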